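/- Notation. $\mathbb{N}=\{1,2,\dots\}$. For an infinite or finite set $A\subseteq\mathbb N$, $A(k)$ is its $k$-th element in increasing order. For finite sets, $t\sqsubseteq s$ means that $t$ is an initial segment of $s$. For a family $\mathcal F$ of finite subsets of $\mathbb N$ let $\widehat{\mathcal F}=\{t:\ t\sqsubseteq s\text{ for some }s\in\mathcal F\}$ and, for infinite $L\subseteq\mathbb N$, $\mathcal F\upharpoonright L=\{s\in\mathcal F: s\subseteq L\}$. The family $\mathcal F$ is *regular thin* if no member of $\mathcal F$ is a proper initial segment of another member, and $\widehat{\mathcal F}$ is hereditary (closed under subsets), spreading (if $\{n_1<\dots<n_k\}\in\widehat{\mathcal F}$, $m_1<\dots<m_k$ and $n_i\le m_i$ for all $i$, then $\{m_1,\dots,m_k\}\in\widehat{\mathcal F}$) and compact (as a set of characteristic functions it is closed in $\{0,1\}^{\mathbb N}$). A tuple $(s_1,\dots,s_l)$ of nonempty finite subsets of $\mathbb N$ is a *plegma family* if $s_i(k)<s_j(k)$ whenever $i<j$ and $1\le k\le\min(|s_i|,|s_j|)$, and $s_i(k)<s_j(k+1)$ for all $i,j$ and $1\le k\le\min(|s_i|,|s_j|-1)$.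 **Theorem 6.12.** Let $X$ be a real Banach space, $\mathcal F$ a regular thin family that contains a nonempty set, $L\subseteq\mathbb N$ infinite, and $(x_s)_{s\in\mathcal F\upharpoonright L}$ a family of vectors of $X$ (an $\mathcal F$-subsequence) such that 1. it is seminormalized: there are $0<c<C$ with $c\le\|x_s\|\le C$ for all $s\in\mathcal F\upharpoonright L$; 2. it is subordinated with respect to the weak topology: there is a continuous map $\widehat\varphi:\widehat{\mathcal F}\upharpoonright L\to(X,w)$ with $\widehat\varphi(s)=x_s$ for all $s\in\mathcal F\upharpoonright L$, where $\widehat{\mathcal F}\upharpoonright L$ has the topology of a subspace of $\{0,1\}^{\mathbb N}$; 3. it is weakly null: for every weakly open $U\ni 0$ there is $m\in\mathbb N$ such that $x_s\in U$ for all $s\in\mathcal F\upharpoonright L$ with $\min s\ge L(m)$. Let $(E,\|\cdot\|_*)$ be a real seminormed space with a Hamel basis $(e_n)_{n\in\mathbb N}$, and suppose that $(x_s)_{s\in\mathcal F\upharpoonright L}$ generates $(e_n)_n$ as an $\mathcal F$-spreading model: there are $\delta_l>0$ with $\delta_l\to0$ such that $$\Big|\,\Big\|\sum_{j=1}^k a_jx_{s_j}\Big\|-\Big\|\sum_{j=1}^k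 a_je_j\Big\|_*\Big|\le\delta_l$$ for all $1\le k\le l$, all $a_1,\dots,a_k\in[-1,1]$ and all plegma families $(s_1,\dots,s_k)$ of members of $\mathcal F\upharpoonright L$ with $s_1(1)\ge L(l)$. Then $(e_n)_n$ is a $1$-unconditional spreading sequence. That is: * (spreading) $\|\sum_{j=1}^n a_je_j\|_*=\|\sum_{j=1}^n a_je_{k_j}\|_*$ for all $n$, all $a_1,\dots,a_n\in\mathbb R$ and all $k_1<\dots<k_n$; * (non trivial) $\|\sum_{j=1}^k a_je_j\|_*\ne0$ whenever $a_1,\dots,a_k\in\mathbb R$ are not all zero, i.e. $\|\cdot\|_*$ is a norm; * ($1$-unconditional) $\|\sum_{n\in G}a_ne_n\|_*\le\|\sum_{n=1}^m a_ne_n\|_*$ for all $m$, all $G\subseteq\{1,\dots,m\}$ and all $a_1,\dots,a_m\in\mathbb R$. -/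

import Mathlib

/-! Families of finite subsets of the natural numbers, plegma families, sequences indexed by a
regular thin family, and the spreading models they generate.

An infinite set of natural numbers is a `Set ℕ`, a finite one a `Finset ℕ`, and a family of finite
sets is a `Set (Finset ℕ)`. The number `0` is allowed as an element (a family of sets of positive
integers is a particular case); positions inside a set are counted from `1`. -/

namespace HOSM

/-- `elt A k` is `A(k)`, the `k`-th element, counted from `1`, of the set `A` in increasing order.
It is only used for `1 ≤ k`, and for `k ≤ |A|` when `A` is finite. -/
noncomputable def elt (A : Set ℕ) (k : ℕ) : ℕ := Nat.nth (fun n => n ∈ A) (k - 1)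

/-- `t` is an initial segment of `s`. -/
def IsInitSeg (t s : Finset ℕ) : Prop :=
  t ⊆ s ∧ ∀ a ∈ s, ∀ b ∈ t, a ≤ b → a ∈ t

/-- The closure `F̂` of `F` under initial segments. -/
def initClosure (F : Set (Finset ℕ)) : Set (Finset ℕ) :=
  {t | ∃ s ∈ F, IsInitSeg t s}

/-- `F ↾ L`, the members of `F` that are subsets of `L`. -/
def restr (F : Set (Finset ℕ)) (L : Set ℕ) : Set (Finset ℕ) :=
  {s | s ∈ F ∧ (s : Set ℕ) ⊆ L}

/-- The characteristic function of a finite set, a point of the Cantor space `{0,1}^ℕ`. -/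
def charFn (s : Finset ℕ) : ℕ → Bool := fun n => decide (n ∈ s)

def IsHereditary (R : Set (Finset ℕ)) : Prop :=
  ∀ s ∈ R, ∀ t, t ⊆ s → t ∈ R

/-- With `{n₁ < ⋯ < n_k}` the family contains every `{m₁ < ⋯ < m_k}` such that `n_i ≤ m_i`
for all `i`. -/
def IsSpreadingFamily (R : Set (Finset ℕ)) : Prop :=
  ∀ s ∈ R, ∀ t : Finset ℕ, t.card = s.card →
    (∀ k, 1 ≤ k → k ≤ s.card → elt s k ≤ elt t k) → t ∈ R

/-- The characteristic functions of the members form a closed subset of `{0,1}^ℕ`. -/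
def IsCompactFamily (R : Set (Finset ℕ)) : Prop :=
  IsClosed (charFn '' R)

def IsRegularFamily (R : Set (Finset ℕ)) : Prop :=
  IsCompactFamily R ∧ IsHereditary R ∧ IsSpreadingFamily R

/-- No member is a proper initial segment of another member. -/
def IsThin (F : Set (Finset ℕ)) : Prop :=
  ∀ s ∈ F, ∀ t ∈ F, IsInitSeg s t → s = t

def IsRegularThin (F : Set (Finset ℕ)) : Prop :=
  IsThin F ∧ IsRegularFamily (initClosure F)

/-- Plegma families `(s_1, …, s_l)`. -/
def IsPlegma {l : ℕ} (s : Fin l → Finset ℕ) : Prop :=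
  (∀ i, (s i).Nonempty) ∧
  (∀ i j : Fin l, i < j → ∀ k, 1 ≤ k → k ≤ min (s i).card (s j).card →
    elt (s i) k < elt (s j) k) ∧
  (∀ i j : Fin l, ∀ k, 1 ≤ k → k ≤ min (s i).card ((s j).card - 1) →
    elt (s i) k < elt (s j) (k + 1))

/-! An `F`-subsequence `(x_s)_{s ∈ F ↾ M}` is given by a function `x : Finset ℕ → Y` of which the
definitions below only use the values at the members of `F ↾ M`. -/

/-- `(x_s)_{s ∈ F ↾ M}` converges to `y`: every open `U ∋ y` contains `x_s` for all `s ∈ F ↾ M`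
with `min s ≥ M(m)`, for some `m`. -/
def FConvergesTo {Y : Type*} [TopologicalSpace Y] (F : Set (Finset ℕ)) (M : Set ℕ)
    (x : Finset ℕ → Y) (y : Y) : Prop :=
  ∀ U : Set Y, IsOpen U → y ∈ U →
    ∃ m, 1 ≤ m ∧ ∀ s ∈ restr F M, (∀ a ∈ s, elt M m ≤ a) → x s ∈ U

/-- `(x_s)_{s ∈ F ↾ M}` is subordinated: `s ↦ x_s` extends to a continuous map on `F̂ ↾ M`,
where `F̂ ↾ M` carries the topology of a subspace of `{0,1}^ℕ`. -/
def IsSubordinated {Y : Type*} [TopologicalSpace Y] (F : Set (Finset ℕ)) (M : Set ℕ)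
    (x : Finset ℕ → Y) : Prop :=
  ∃ φ : (ℕ → Bool) → Y, ContinuousOn φ (charFn '' restr (initClosure F) M) ∧
    ∀ s ∈ restr F M, φ (charFn s) = x s

section Banach

variable {X : Type*} [NormedAddCommGroup X] [NormedSpace ℝ X]

def IsSeminormalized (F : Set (Finset ℕ)) (M : Set ℕ) (x : Finset ℕ → X) : Prop :=
  ∃ c C : ℝ, 0 < c ∧ c < C ∧ ∀ s ∈ restr F M, c ≤ ‖x s‖ ∧ ‖x s‖ ≤ C

def IsWeaklyNull (F : Set (Finset ℕ)) (M : Set ℕ) (x : Finset ℕ → X) : Prop :=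
  FConvergesTo F M (fun s => toWeakSpace ℝ X (x s)) 0

def IsWeaklySubordinated (F : Set (Finset ℕ)) (M : Set ℕ) (x : Finset ℕ → X) : Prop :=
  IsSubordinated F M (fun s => toWeakSpace ℝ X (x s))

end Banach

section Seminormed

variable {E : Type*} [SeminormedAddCommGroup E] [NormedSpace ℝ E]

/-- `(x_s)_{s ∈ F ↾ M}` generates `(e_n)` as an `F`-spreading model. The sequence `(e_n)` is
indexed from `0`, so `e j` for `j : Fin k` runs through its first `k` terms. -/
def GeneratesSpreadingModel {X : Type*} [NormedAddCommGroup X] [NormedSpace ℝ X]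
    (F : Set (Finset ℕ)) (M : Set ℕ) (x : Finset ℕ → X) (e : ℕ → E) : Prop :=
  ∃ δ : ℕ → ℝ, (∀ n, 0 < δ n) ∧ Filter.Tendsto δ Filter.atTop (nhds 0) ∧
    ∀ (l k : ℕ) (hk : 1 ≤ k), k ≤ l →
      ∀ a : Fin k → ℝ, (∀ j, a j ∈ Set.Icc (-1 : ℝ) 1) →
      ∀ s : Fin k → Finset ℕ, (∀ j, s j ∈ restr F M) → IsPlegma s →
        elt M l ≤ elt (s ⟨0, hk⟩) 1 →
        |‖∑ j, a j • x (s j)‖ - ‖∑ j : Fin k, a j • e j‖| ≤ δ l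

def IsSpreadingSeq (e : ℕ → E) : Prop :=
  ∀ (n : ℕ) (a : Fin n → ℝ) (k : Fin n → ℕ), StrictMono k →
    ‖∑ j : Fin n, a j • e j‖ = ‖∑ j, a j • e (k j)‖

/-- Some linear combination with coefficients not all zero has seminorm zero. -/
def IsTrivialSeq (e : ℕ → E) : Prop :=
  ∃ (k : ℕ) (a : Fin k → ℝ), (∃ j, a j ≠ 0) ∧ ‖∑ j : Fin k, a j • e j‖ = 0

/-- `C`-unconditional sequences. -/
def IsUnconditionalSeq (C : ℝ) (e : ℕ → E) : Prop :=
  ∀ (m : ℕ) (G : Finset ℕ), G ⊆ Finset.range m → ∀ a : ℕ → ℝ,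
    ‖∑ n ∈ G, a n • e n‖ ≤ C * ‖∑ n ∈ Finset.range m, a n • e n‖

end Seminormed

end HOSM

/-!
Let `T = F̂ ↾ L`, a tree under end-extension, and let `φ` be the weakly continuous extension of
`s ↦ x s` to `T`. The tree is well-founded because `F̂` is compact
(`wellFoundedOn_gt_of_isCompactFamily`). If `t ∈ T` is not in `F`, then `t ∪ {n} ∈ T` for all large
`n ∈ L` (`eventually_insert_mem`) and `φ (t ∪ {n}) → φ t` weakly, so by Mazur's theorem `φ t` is
norm-close to a convex combination of the `φ (t ∪ {n})` with `n` in a finite window `[u, v)`. There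
are only finitely many `t ⊆ [0, u)`, so one window serves them all (`exists_window`). In this way
one fixes consecutive windows before looking at any branch of the tree, and deals them out to `N`
columns. Well-founded induction along a column shows that `φ ∅` is close to a convex combination of
vectors `x s`, with the `k`-th element of `s` in the `k`-th window of the column
(`mem_convexHull_column`). Since `(x s)` is weakly null, `φ ∅ = 0`. Members of `F` taken from distinct
columns form a plegma family (`isPlegma_of_inColumn`); all of this is `exists_plegma_columns`.

In a linear combination over such a plegma family, the vector of one column may be averaged to
almost `0` while those of the other columns stay fixed, and each sum averaged has norm close to that
of the corresponding combination of the `e j`. Hence deleting a term does not increase the norm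
(`norm_sum_update_le_of_generates`), which is `1`-unconditionality. The sequence is spreading
because a subfamily of a plegma family is a plegma family (`isSpreadingSeq_of_generates`), and it is
not trivial because it is unconditional with `‖e n‖ = ‖e 0‖ ≥ c > 0`.
-/

namespace HOSM

open Filter Topology
open scoped Pointwise

/-! ### Positions in finite sets -/

theorem lt_card_toFinset {s : Finset ℕ} {k : ℕ} (hk : k < s.card)
    (hf : (Set.ofPred fun n => n ∈ (s : Set ℕ)).Finite) : k < hf.toFinset.card := by
  have : hf.toFinset = s := by ext; simp
  rwa [this]

theorem elt_mem {s : Finset ℕ} {k : ℕ} (h1 : 1 ≤ k) (hk : k ≤ s.card) : elt s k ∈ s := by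
  have := Nat.nth_mem (p := fun n => n ∈ (s : Set ℕ)) (k - 1)
    fun hf => lt_card_toFinset (by omega) hf
  exact this

theorem count_elt {s : Finset ℕ} {k : ℕ} (h1 : 1 ≤ k) (hk : k ≤ s.card) :
    Nat.count (· ∈ s) (elt s k) = k - 1 := by
  classical
  have := Nat.count_nth (p := fun n => n ∈ (s : Set ℕ)) (n := k - 1)
    fun hf => lt_card_toFinset (by omega) hf
  rw [← this]
  simp [elt]

theorem elt_count {s : Finset ℕ} {a : ℕ} (ha : a ∈ s) :
    elt s (Nat.count (· ∈ s) a + 1) = a :=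
  Nat.nth_count (p := (· ∈ s)) ha

theorem count_insert {t : Finset ℕ} {n a : ℕ} (ha : a ≤ n) :
    Nat.count (· ∈ insert n t) a = Nat.count (· ∈ t) a := by
  simp only [Nat.count_eq_card_filter_range]
  congr 1
  refine Finset.filter_congr fun b hb => ?_
  have := Finset.mem_range.1 hb
  simp only [Finset.mem_insert]
  exact or_iff_right (by omega)

theorem count_eq_card {t : Finset ℕ} {n : ℕ} (h : ∀ a ∈ t, a < n) :
    Nat.count (· ∈ t) n = t.card := by
  rw [Nat.count_eq_card_filter_range]
  congr 1
  ext a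
  simpa using h a

theorem count_lt_card {t : Finset ℕ} {a : ℕ} (ha : a ∈ t) :
    Nat.count (· ∈ t) a < t.card := by
  rw [Nat.count_eq_card_filter_range]
  refine Finset.card_lt_card (Finset.ssubset_iff_of_subset ?_ |>.2 ⟨a, ha, ?_⟩)
  · intro b hb
    exact (Finset.mem_filter.1 hb).2
  · simp

theorem elt_insert_of_le {t : Finset ℕ} {n k : ℕ} (h : ∀ a ∈ t, a < n) (h1 : 1 ≤ k)
    (hk : k ≤ t.card) : elt (insert n t : Finset ℕ) k = elt t k := by
  have hm := elt_mem h1 hk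
  have := elt_count (Finset.mem_insert_of_mem (b := n) hm)
  rwa [count_insert (h _ hm).le, count_elt h1 hk, Nat.sub_add_cancel h1] at this

theorem elt_insert_last {t : Finset ℕ} {n : ℕ} (h : ∀ a ∈ t, a < n) :
    elt (insert n t : Finset ℕ) (t.card + 1) = n := by
  have := elt_count (Finset.mem_insert_self n t)
  rwa [count_insert le_rfl, count_eq_card h] at this

/-! ### Regular thin families as trees -/

theorem subset_initClosure (F : Set (Finset ℕ)) : F ⊆ initClosure F :=
  fun s hs => ⟨s, hs, Finset.Subset.refl s, fun _ ha _ _ _ => ha⟩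

theorem restr_subset_restr_initClosure (F : Set (Finset ℕ)) (L : Set ℕ) :
    restr F L ⊆ restr (initClosure F) L :=
  fun _ hs => ⟨subset_initClosure F hs.1, hs.2⟩

/-- A node `t` of the tree `F̂` that is not in `F` has all far away one-point end-extensions
in `F̂`: some one-point extension is in `F̂` because `t` is a proper initial segment of a member
of `F`, and the others are obtained by spreading. -/
theorem eventually_insert_mem {F : Set (Finset ℕ)} (hF : IsRegularThin F) {t : Finset ℕ}
    (ht : t ∈ initClosure F) (htF : t ∉ F) : ∀ᶠ n in atTop, insert n t ∈ initClosure F := by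
  obtain ⟨-, -, hher, hspr⟩ := hF
  obtain ⟨s, hs, hts, hinit⟩ := ht
  obtain ⟨b, hbs, hbt⟩ : ∃ b ∈ s, b ∉ t := by
    by_contra! h
    exact htF (hts.antisymm h ▸ hs)
  have hb : ∀ a ∈ t, a < b := fun a ha => by
    by_contra! h
    exact hbt (hinit b hbs a ha h)
  filter_upwards [eventually_ge_atTop b] with n hn
  have hn' : ∀ a ∈ t, a < n := fun a ha => (hb a ha).trans_le hn
  have hbt' : insert b t ∈ initClosure F :=
    hher s (subset_initClosure F hs) _ (Finset.insert_subset hbs hts)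
  have hcard : (insert b t).card = t.card + 1 := Finset.card_insert_of_notMem hbt
  refine hspr _ hbt' _ ?_ fun k h1 hk => ?_
  · rw [hcard, Finset.card_insert_of_notMem fun h => (hn' n h).false]
  · rcases (hcard ▸ hk).lt_or_eq with h | rfl
    · rw [elt_insert_of_le hb h1 (by omega), elt_insert_of_le hn' h1 (by omega)]
    · rwa [elt_insert_last hb, elt_insert_last hn']

/-- A compact family contains no infinite strictly increasing chain: the union of such a chain
would be an infinite member. -/
theorem wellFoundedOn_gt_of_isCompactFamily {R : Set (Finset ℕ)} (hR : IsCompactFamily R) :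
    R.WellFoundedOn (· > ·) := by
  classical
  refine Set.wellFoundedOn_iff_no_descending_seq.2 fun f hf => ?_
  have hmono : StrictMono f := fun i j hij => f.map_rel_iff.2 hij
  let g : ℕ → Bool := fun n => decide (∃ k, n ∈ f k)
  have hlim : Tendsto (fun k => charFn (f k)) atTop (𝓝 g) := by
    refine tendsto_pi_nhds.2 fun n => tendsto_const_nhds.congr' ?_
    by_cases h : ∃ k, n ∈ f k
    · obtain ⟨k, hk⟩ := h
      filter_upwards [eventually_ge_atTop k] with m hm
      have h1 : n ∈ f m := hmono.monotone hm hk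
      have h2 : ∃ k, n ∈ f k := ⟨k, hk⟩
      simp [g, charFn, h1, h2]
    · refine Eventually.of_forall fun m => ?_
      have h1 : n ∉ f m := fun hm => h ⟨m, hm⟩
      simp only [g, charFn, h, h1]
  obtain ⟨s, -, hs⟩ := hR.mem_of_tendsto hlim (Eventually.of_forall fun k =>
    Set.mem_image_of_mem charFn (hf k))
  have hsub : ∀ k, f k ⊆ s := fun k n hn => by
    have := congrFun hs n
    have h2 : ∃ k, n ∈ f k := ⟨k, hn⟩
    simpa [charFn, g, h2] using this
  have hcard : StrictMono fun k => (f k).card := fun i j hij => Finset.card_lt_card (hmono hij)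
  have := (hcard.id_le (s.card + 1)).trans (Finset.card_le_card (hsub _))
  simp at this

theorem tendsto_charFn_insert (t : Finset ℕ) :
    Tendsto (fun n => charFn (insert n t)) atTop (𝓝 (charFn t)) := by
  refine tendsto_pi_nhds.2 fun m => tendsto_const_nhds.congr' ?_
  filter_upwards [eventually_gt_atTop m] with n hn
  simp [charFn, hn.ne]

/-! ### Convex combinations over windows -/

section Windows

variable {X : Type*} [NormedAddCommGroup X] [NormedSpace ℝ X]

/-- Mazur's theorem for a sequence that converges weakly along an infinite set of indices: the
weak limit is norm-approximated by convex combinations of finitely many far away terms. -/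
theorem exists_convexHull_of_tendsto_weak {f : ℕ → X} {S : Set ℕ} (hS : S.Infinite) {y : X}
    (h : Tendsto (fun n => toWeakSpace ℝ X (f n)) (atTop ⊓ 𝓟 S) (𝓝 (toWeakSpace ℝ X y)))
    (u : ℕ) {δ : ℝ} (hδ : 0 < δ) :
    ∃ v, ∃ z ∈ convexHull ℝ (f '' (S ∩ Set.Ico u v)), ‖y - z‖ ≤ δ := by
  classical
  have : (atTop ⊓ 𝓟 S).NeBot :=
    frequently_mem_iff_neBot.1 (Nat.frequently_atTop_iff_infinite.2 hS)
  have hev : ∀ᶠ n in atTop ⊓ 𝓟 S, toWeakSpace ℝ X (f n) ∈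
      toWeakSpace ℝ X '' convexHull ℝ (f '' (S ∩ Set.Ici u)) := by
    filter_upwards [mem_inf_of_left (Ici_mem_atTop u), mem_inf_of_right (mem_principal_self S)]
      with n hn hnS
    exact Set.mem_image_of_mem _ (subset_convexHull ℝ _ ⟨n, ⟨hnS, hn⟩, rfl⟩)
  have hmem := mem_closure_of_tendsto h hev
  rw [← (convex_convexHull ℝ _).toWeakSpace_closure ℝ,
    (toWeakSpace ℝ X).injective.mem_set_image] at hmem
  obtain ⟨z, hz, hyz⟩ := Metric.mem_closure_iff.1 hmem δ hδ
  rw [convexHull_eq_union_convexHull_finite_subsets] at hz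
  simp only [Set.mem_iUnion] at hz
  obtain ⟨A, hA, hz⟩ := hz
  obtain ⟨B, hB, rfl⟩ := Finset.subset_set_image_iff.1 hA
  refine ⟨B.sup id + 1, z, convexHull_mono ?_ hz, (dist_eq_norm y z ▸ hyz).le⟩
  rw [Finset.coe_image]
  refine Set.image_mono fun n hn => ⟨(hB hn).1, (hB hn).2, ?_⟩
  exact Nat.lt_succ_of_le (Finset.le_sup (f := id) hn)

/-- The one-point extensions of `t` inside `F̂ ↾ L` by a number of the window `[u, v)`. -/
def windowChildren (F : Set (Finset ℕ)) (L : Set ℕ) (u v : ℕ) (t : Finset ℕ) : Set (Finset ℕ) :=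
  {s | s ∈ restr (initClosure F) L ∧ ∃ n ∈ Set.Ico u v, s = insert n t}

theorem windowChildren_mono (F : Set (Finset ℕ)) (L : Set ℕ) (u : ℕ) {v w : ℕ} (h : v ≤ w)
    (t : Finset ℕ) : windowChildren F L u v t ⊆ windowChildren F L u w t := by
  rintro s ⟨hs, n, hn, rfl⟩
  exact ⟨hs, n, ⟨hn.1, hn.2.trans_le h⟩, rfl⟩

/-- A window `[u, v)` that serves all the nodes `t ⊆ [0, u)` of the tree `F̂ ↾ L` at once: each
`ψ t` is approximated by convex combinations of the `ψ s`, with `s` a child of `t` through the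
window. -/
theorem exists_window {F : Set (Finset ℕ)} (hF : IsRegularThin F) {L : Set ℕ} (hL : L.Infinite)
    {φ : (ℕ → Bool) → WeakSpace ℝ X} {ψ : Finset ℕ → X}
    (hφ : ContinuousOn φ (charFn '' restr (initClosure F) L))
    (hψ : ∀ t, toWeakSpace ℝ X (ψ t) = φ (charFn t)) (u : ℕ) {δ : ℝ} (hδ : 0 < δ) :
    ∃ v, u < v ∧ ∀ t ∈ restr (initClosure F) L, t ∉ F → (∀ a ∈ t, a < u) →
      ∃ z ∈ convexHull ℝ (ψ '' windowChildren F L u v t), ‖ψ t - z‖ ≤ δ := by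
  classical
  have key : ∀ t : Finset ℕ, ∃ v, t ∈ restr (initClosure F) L → t ∉ F →
      ∃ z ∈ convexHull ℝ (ψ '' windowChildren F L u v t), ‖ψ t - z‖ ≤ δ := by
    intro t
    by_cases ht : t ∈ restr (initClosure F) L ∧ t ∉ F
    swap
    · exact ⟨0, fun h1 h2 => absurd ⟨h1, h2⟩ ht⟩
    obtain ⟨n₀, hn₀⟩ := eventually_atTop.1 (eventually_insert_mem hF ht.1.1 ht.2)
    have hins : ∀ n ∈ L, n₀ ≤ n → insert n t ∈ restr (initClosure F) L := fun n hn hn' =>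
      ⟨hn₀ n hn', by rw [Finset.coe_insert]; exact Set.insert_subset hn ht.1.2⟩
    have hlim : Tendsto (fun n => toWeakSpace ℝ X (ψ (insert n t))) (atTop ⊓ 𝓟 L)
        (𝓝 (toWeakSpace ℝ X (ψ t))) := by
      simp only [hψ]
      refine (hφ _ (Set.mem_image_of_mem _ ht.1)).tendsto.comp
        (tendsto_nhdsWithin_iff.2 ⟨(tendsto_charFn_insert t).mono_left inf_le_left, ?_⟩)
      filter_upwards [mem_inf_of_left (Ici_mem_atTop n₀),
        mem_inf_of_right (mem_principal_self L)] with n hn hnL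
      exact Set.mem_image_of_mem _ (hins n hnL hn)
    obtain ⟨v, z, hz, hzδ⟩ := exists_convexHull_of_tendsto_weak hL hlim (max u n₀) hδ
    refine ⟨v, fun _ _ => ⟨z, convexHull_mono ?_ hz, hzδ⟩⟩
    rintro _ ⟨n, ⟨hnL, hn, hnv⟩, rfl⟩
    exact ⟨_, ⟨hins n hnL ((le_max_right _ _).trans hn), n, ⟨(le_max_left _ _).trans hn, hnv⟩,
      rfl⟩, rfl⟩
  choose v hv using key
  refine ⟨max (u + 1) ((Finset.range u).powerset.sup v), by simp, fun t ht htF htu => ?_⟩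
  obtain ⟨z, hz, hzδ⟩ := hv t ht htF
  refine ⟨z, convexHull_mono (Set.image_mono (windowChildren_mono F L u ?_ t)) hz, hzδ⟩
  exact (Finset.le_sup (f := v) (Finset.mem_powerset.2 fun a ha =>
    Finset.mem_range.2 (htu a ha))).trans (le_max_right _ _)

/-- The windows `[u m, u (m + 1))` are dealt out cyclically to `N` columns, and `s` lies in the
`j`-th column when its `k`-th element, with `k` counted from `0`, is in the `k`-th window of that
column, which is the one with `m = k * N + j`. -/
def InColumn (u : ℕ → ℕ) (N j : ℕ) (s : Finset ℕ) : Prop :=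
  ∀ a ∈ s, u (Nat.count (· ∈ s) a * N + j) ≤ a ∧ a < u (Nat.count (· ∈ s) a * N + j + 1)

theorem InColumn.lt {u : ℕ → ℕ} (hu : StrictMono u) {N j : ℕ} {t : Finset ℕ}
    (ht : InColumn u N j t) (hj : j < N) : ∀ a ∈ t, a < u (t.card * N + j) := by
  intro a ha
  refine (ht a ha).2.trans_le (hu.monotone ?_)
  have := count_lt_card ha
  nlinarith

theorem InColumn.insert {u : ℕ → ℕ} (hu : StrictMono u) {N j n : ℕ} {t : Finset ℕ}
    (ht : InColumn u N j t) (hj : j < N) (h1 : u (t.card * N + j) ≤ n)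
    (h2 : n < u (t.card * N + j + 1)) : InColumn u N j (insert n t) := by
  have hlt : ∀ a ∈ t, a < n := fun a ha => (ht.lt hu hj a ha).trans_le h1
  intro a ha
  rcases Finset.mem_insert.1 ha with rfl | ha
  · rw [count_insert le_rfl, count_eq_card hlt]
    exact ⟨h1, h2⟩
  · rw [count_insert (hlt a ha).le]
    exact ht a ha

/-- Starting from a node of a column, one follows the tree through the windows of that column. The
tree is well-founded, so this ends in members of `F`, and the errors of the successive
convex approximations form a geometric series. -/
theorem mem_convexHull_column {F : Set (Finset ℕ)} (hF : IsRegularThin F) {L : Set ℕ}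
    {ψ : Finset ℕ → X} {u : ℕ → ℕ} (hu : StrictMono u) {ε : ℝ}
    (hwin : ∀ m, ∀ t ∈ restr (initClosure F) L, t ∉ F → (∀ a ∈ t, a < u m) →
      ∃ z ∈ convexHull ℝ (ψ '' windowChildren F L (u m) (u (m + 1)) t),
        ‖ψ t - z‖ ≤ ε / 2 ^ (m + 1))
    (hε : 0 ≤ ε) {N j : ℕ} (hj : j < N) {t : Finset ℕ} (ht : t ∈ restr (initClosure F) L)
    (htj : InColumn u N j t) :
    ψ t ∈ convexHull ℝ (ψ '' {s | s ∈ restr F L ∧ InColumn u N j s}) +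
      Metric.closedBall 0 (ε / 2 ^ t.card) := by
  refine (wellFoundedOn_gt_of_isCompactFamily hF.2.1).induction ht.1
    (P := fun t => t ∈ restr (initClosure F) L → InColumn u N j t →
      ψ t ∈ convexHull ℝ (ψ '' {s | s ∈ restr F L ∧ InColumn u N j s}) +
        Metric.closedBall 0 (ε / 2 ^ t.card)) ?_ ht htj
  clear! t
  intro t ht0 ih ht htj
  by_cases htF : t ∈ F
  · refine ⟨ψ t, subset_convexHull ℝ _ ⟨t, ⟨⟨htF, ht.2⟩, htj⟩, rfl⟩, 0, ?_, add_zero _⟩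
    simp only [Metric.mem_closedBall, dist_self]
    positivity
  obtain ⟨z, hz, hzε⟩ := hwin (t.card * N + j) t ht htF (htj.lt hu hj)
  have hsub : ψ '' windowChildren F L (u (t.card * N + j)) (u (t.card * N + j + 1)) t ⊆
      convexHull ℝ (ψ '' {s | s ∈ restr F L ∧ InColumn u N j s}) +
      Metric.closedBall 0 (ε / 2 ^ (t.card + 1)) := by
    rintro _ ⟨_, ⟨hs, n, hn, rfl⟩, rfl⟩
    have hnt : n ∉ t := fun h => absurd hn.1 (htj.lt hu hj n h).not_ge
    rw [← Finset.card_insert_of_notMem hnt]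
    exact ih _ hs.1 (Finset.ssubset_insert hnt) hs (htj.insert hu hj hn.1 hn.2)
  obtain ⟨w, hw, r, hr, hwr⟩ :=
    convexHull_min hsub ((convex_convexHull ℝ _).add (convex_closedBall _ _)) hz
  refine ⟨w, hw, ψ t - w, ?_, by abel_nf⟩
  rw [mem_closedBall_zero_iff] at hr ⊢
  have hpow : ε / 2 ^ (t.card * N + j + 1) ≤ ε / 2 ^ (t.card + 1) := by
    gcongr
    · norm_num
    · nlinarith
  calc ‖ψ t - w‖ = ‖(ψ t - z) + r‖ := by rw [← hwr]; congr 1; simp only; abel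
    _ ≤ ‖ψ t - z‖ + ‖r‖ := norm_add_le _ _
    _ ≤ ε / 2 ^ (t.card + 1) + ε / 2 ^ (t.card + 1) := by gcongr; exact hzε.trans hpow
    _ = ε / 2 ^ t.card := by rw [pow_succ]; ring

/-- Windows beyond `u₀` such that, for any number of columns, the value of `ψ` at the root is
approximated by convex combinations of its values at the members of `F` in any one column. -/
theorem exists_columns {F : Set (Finset ℕ)} (hF : IsRegularThin F) (hne : F.Nonempty)
    {L : Set ℕ} (hL : L.Infinite) {φ : (ℕ → Bool) → WeakSpace ℝ X} {ψ : Finset ℕ → X}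
    (hφ : ContinuousOn φ (charFn '' restr (initClosure F) L))
    (hψ : ∀ t, toWeakSpace ℝ X (ψ t) = φ (charFn t)) (u₀ : ℕ) {ε : ℝ} (hε : 0 < ε) :
    ∃ u : ℕ → ℕ, StrictMono u ∧ u 0 = u₀ ∧ ∀ N j, j < N →
      ∃ z ∈ convexHull ℝ (ψ '' {s | s ∈ restr F L ∧ InColumn u N j s}), ‖ψ ∅ - z‖ ≤ ε := by
  choose v hv hv' using fun (u m : ℕ) =>
    exists_window hF hL hφ hψ u (δ := ε / 2 ^ (m + 1)) (by positivity)
  let u : ℕ → ℕ := fun m => Nat.rec u₀ (fun m w => v w m) m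
  have hu : StrictMono u := strictMono_nat_of_lt_succ fun m => hv (u m) m
  obtain ⟨s, hs⟩ := hne
  have h0 : (∅ : Finset ℕ) ∈ restr (initClosure F) L :=
    ⟨hF.2.2.1 s (subset_initClosure F hs) _ (Finset.empty_subset s), by simp⟩
  refine ⟨u, hu, rfl, fun N j hj => ?_⟩
  obtain ⟨z, hz, r, hr, hzr⟩ := mem_convexHull_column hF hu (fun m => hv' (u m) m) hε.le hj h0
    (fun a ha => absurd ha (Finset.notMem_empty a))
  refine ⟨z, hz, ?_⟩
  simp only at hzr
  rw [← hzr, add_sub_cancel_left]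
  simpa using hr

end Windows

/-! ### Plegma families from distinct columns -/

theorem InColumn.le_elt {u : ℕ → ℕ} {N j k : ℕ} {s : Finset ℕ} (hs : InColumn u N j s)
    (h1 : 1 ≤ k) (hk : k ≤ s.card) : u ((k - 1) * N + j) ≤ elt s k := by
  simpa [count_elt h1 hk] using (hs _ (elt_mem h1 hk)).1

theorem InColumn.elt_lt {u : ℕ → ℕ} {N j k : ℕ} {s : Finset ℕ} (hs : InColumn u N j s)
    (h1 : 1 ≤ k) (hk : k ≤ s.card) : elt s k < u ((k - 1) * N + j + 1) := by
  simpa [count_elt h1 hk] using (hs _ (elt_mem h1 hk)).2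

theorem isPlegma_of_inColumn {u : ℕ → ℕ} (hu : StrictMono u) {N k : ℕ} {c : Fin k → ℕ}
    (hc : StrictMono c) (hcN : ∀ i, c i < N) {s : Fin k → Finset ℕ} (hne : ∀ i, (s i).Nonempty)
    (hs : ∀ i, InColumn u N (c i) (s i)) : IsPlegma s := by
  refine ⟨hne, fun i j hij m h1 hm => ?_, fun i j m h1 hm => ?_⟩
  · refine ((hs i).elt_lt h1 (by omega)).trans_le
      ((hu.monotone ?_).trans ((hs j).le_elt h1 (by omega)))
    have := hc hij
    omega
  · refine ((hs i).elt_lt h1 (by omega)).trans_le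
      ((hu.monotone ?_).trans ((hs j).le_elt (by omega) (by omega)))
    obtain ⟨m, rfl⟩ := Nat.exists_eq_add_of_le' h1
    have := hcN i
    simp only [Nat.add_sub_cancel]
    nlinarith

section Banach

variable {X : Type*} [NormedAddCommGroup X] [NormedSpace ℝ X]

/-- Given `l` and `N`, there are sets `W 0, …, W (N - 1)` of members of `F ↾ L` such that one
member from each of them, or from some of them, always form a plegma family beyond `L(l)`, while
each `W j` carries a convex combination of the `x s` of arbitrarily small norm. -/
theorem exists_plegma_columns {F : Set (Finset ℕ)} (hF : IsRegularThin F)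
    (hF1 : ∃ s ∈ F, s.Nonempty) {L : Set ℕ} (hL : L.Infinite) {x : Finset ℕ → X}
    (hsub : IsWeaklySubordinated F L x) (hnull : IsWeaklyNull F L x) (l N : ℕ) {ε : ℝ}
    (hε : 0 < ε) :
    ∃ W : ℕ → Set (Finset ℕ), (∀ j < N, W j ⊆ restr F L) ∧
      (∀ j < N, ∃ z ∈ convexHull ℝ (x '' W j), ‖z‖ ≤ ε) ∧
      ∀ (k : ℕ) (hk : 1 ≤ k) (c : Fin k → ℕ), StrictMono c → (∀ i, c i < N) →
        ∀ s : Fin k → Finset ℕ, (∀ i, s i ∈ W (c i)) →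
          IsPlegma s ∧ elt L l ≤ elt (s ⟨0, hk⟩) 1 := by
  obtain ⟨φ, hφ, hφx⟩ := hsub
  obtain ⟨s₀, hs₀, hs₀ne⟩ := hF1
  have hempty : ∅ ∉ F := fun h => hs₀ne.ne_empty
    (hF.1 ∅ h s₀ hs₀ ⟨Finset.empty_subset _, fun _ _ b hb => absurd hb (by simp)⟩).symm
  let ψ : Finset ℕ → X := fun t => (toWeakSpace ℝ X).symm (φ (charFn t))
  have hψ : ∀ t, toWeakSpace ℝ X (ψ t) = φ (charFn t) := fun t =>
    (toWeakSpace ℝ X).apply_symm_apply _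
  have hψx : ∀ s ∈ restr F L, ψ s = x s := fun s hs =>
    (toWeakSpace ℝ X).injective ((hψ s).trans (hφx s hs))
  have hcol := fun u₀ ε hε => exists_columns hF ⟨s₀, hs₀⟩ hL hφ hψ u₀ (ε := ε) hε
  have hψ0 : ψ ∅ = 0 := by
    have hfar : ∀ u₀ : ℕ, ∃ s ∈ restr F L, ∀ a ∈ s, u₀ ≤ a := by
      intro u₀
      obtain ⟨u, hu, hu0, h⟩ := hcol u₀ 1 one_pos
      obtain ⟨z, hz, -⟩ := h 1 0 one_pos
      obtain ⟨_, s, hs, rfl⟩ := convexHull_nonempty_iff.1 ⟨z, hz⟩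
      exact ⟨s, hs.1, fun a ha => hu0 ▸ (hu.monotone (Nat.zero_le _)).trans (hs.2 a ha).1⟩
    choose s hs hsfar using hfar
    have hchar : Tendsto (fun i => charFn (s i)) atTop (𝓝 (charFn ∅)) := by
      refine tendsto_pi_nhds.2 fun m => tendsto_const_nhds.congr' ?_
      filter_upwards [eventually_gt_atTop m] with i hi
      have : m ∉ s i := fun h => (hsfar i m h).not_gt hi
      simp [charFn, this]
    have h0 : (∅ : Finset ℕ) ∈ restr (initClosure F) L :=
      ⟨hF.2.2.1 s₀ (subset_initClosure F hs₀) _ (Finset.empty_subset s₀), by simp⟩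
    have h1 : Tendsto (fun i => φ (charFn (s i))) atTop (𝓝 (φ (charFn ∅))) :=
      (hφ _ (Set.mem_image_of_mem _ h0)).tendsto.comp (tendsto_nhdsWithin_iff.2
        ⟨hchar, Eventually.of_forall fun i =>
          Set.mem_image_of_mem _ (restr_subset_restr_initClosure F L (hs i))⟩)
    have h2 : Tendsto (fun i => φ (charFn (s i))) atTop (𝓝 0) := by
      refine tendsto_nhds.2 fun U hU hU0 => ?_
      obtain ⟨m, -, hm⟩ := hnull U hU hU0
      filter_upwards [eventually_ge_atTop (elt L m)] with i hi
      rw [Set.mem_preimage, hφx _ (hs i)]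
      exact hm _ (hs i) fun a ha => hi.trans (hsfar i a ha)
    exact (toWeakSpace ℝ X).injective (by rw [hψ, map_zero, tendsto_nhds_unique h1 h2])
  obtain ⟨u, hu, hu0, h⟩ := hcol (elt L l) ε hε
  refine ⟨fun j => {s | s ∈ restr F L ∧ InColumn u N j s}, fun j _ s hs => hs.1,
    fun j hj => ?_, fun k hk c hc hcN s hs => ?_⟩
  · obtain ⟨z, hz, hzε⟩ := h N j hj
    rw [hψ0, zero_sub, norm_neg] at hzε
    rw [Set.image_congr fun s hs => hψx s hs.1] at hz
    exact ⟨z, hz, hzε⟩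
  · have hne : ∀ i, (s i).Nonempty := fun i =>
      Finset.nonempty_iff_ne_empty.2 fun h => hempty (h ▸ (hs i).1.1)
    refine ⟨isPlegma_of_inColumn hu hc hcN hne fun i => (hs i).2, ?_⟩
    rw [← hu0]
    exact (hu.monotone (Nat.zero_le _)).trans ((hs _).2.le_elt le_rfl (hne _).card_pos)

end Banach

/-! ### Passing from the vectors to the spreading model -/

theorem exists_smul_mem_Icc {ι : Type*} [Fintype ι] (a : ι → ℝ) :
    ∃ c : ℝ, 0 < c ∧ ∃ b : ι → ℝ, (∀ j, b j ∈ Set.Icc (-1 : ℝ) 1) ∧ a = c • b := by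
  have hc : 0 < 1 + ‖a‖ := by positivity
  refine ⟨1 + ‖a‖, hc, fun j => a j / (1 + ‖a‖), fun j => ?_, ?_⟩
  · rw [Set.mem_Icc, ← abs_le, abs_div, abs_of_pos hc, div_le_one hc]
    exact (norm_le_pi_norm a j).trans (by linarith)
  · ext j
    simp only [Pi.smul_apply, smul_eq_mul]
    field_simp

theorem norm_sum_smul_smul {ι E : Type*} [Fintype ι] [SeminormedAddCommGroup E]
    [NormedSpace ℝ E] {c : ℝ} (hc : 0 < c) (b : ι → ℝ) (v : ι → E) :
    ‖∑ j, (c • b) j • v j‖ = c * ‖∑ j, b j • v j‖ := by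
  simp only [Pi.smul_apply, smul_assoc, ← Finset.smul_sum, norm_smul, Real.norm_of_nonneg hc.le]

/-- A linear combination over positions `k j` below `N`, as one over all positions below `N`. -/
theorem sum_extend_smul {V : Type*} [AddCommGroup V] [Module ℝ V] {n N : ℕ} {k : Fin n → ℕ}
    (hN : ∀ j, k j < N) (a : Fin n → ℝ) (v : Fin N → V) :
    ∑ i : Fin N, (∑ j, if k j = i then a j else 0) • v i = ∑ j, a j • v ⟨k j, hN j⟩ := by
  simp only [Finset.sum_smul, ite_smul, zero_smul]
  rw [Finset.sum_comm]
  refine Finset.sum_congr rfl fun j _ => ?_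
  rw [Finset.sum_eq_single ⟨k j, hN j⟩ (fun i _ hi => if_neg fun h => hi (Fin.ext h.symm))
    (fun h => absurd (Finset.mem_univ _) h), if_pos rfl]

section SpreadingModel

variable {X : Type*} [NormedAddCommGroup X] [NormedSpace ℝ X]
variable {E : Type*} [SeminormedAddCommGroup E] [NormedSpace ℝ E]

/-- Choose one vector from each of `k (n - 1) + 1` columns. The vectors of the columns `k j` are
part of this plegma family and form a plegma family themselves, so the norm of their linear
combination is close to that of `∑ a j • e j` and to that of `∑ a j • e (k j)`. -/
theorem isSpreadingSeq_of_generates {F : Set (Finset ℕ)} (hF : IsRegularThin F)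
    (hF1 : ∃ s ∈ F, s.Nonempty) {L : Set ℕ} (hL : L.Infinite) {x : Finset ℕ → X} {e : ℕ → E}
    (hgen : GeneratesSpreadingModel F L x e) (hsub : IsWeaklySubordinated F L x)
    (hnull : IsWeaklyNull F L x) : IsSpreadingSeq e := by
  obtain ⟨δ, -, hδ, hgen⟩ := hgen
  suffices h : ∀ (n : ℕ) (a : Fin n → ℝ), (∀ j, a j ∈ Set.Icc (-1 : ℝ) 1) → ∀ k : Fin n → ℕ,
      StrictMono k → ‖∑ j : Fin n, a j • e j‖ = ‖∑ j, a j • e (k j)‖ by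
    intro n a k hk
    obtain ⟨c, hc, b, hb, rfl⟩ := exists_smul_mem_Icc a
    rw [norm_sum_smul_smul hc, norm_sum_smul_smul hc, h n b hb k hk]
  intro n a ha k hk
  rcases Nat.eq_zero_or_pos n with rfl | hn
  · simp
  obtain ⟨N, hN⟩ : ∃ N, ∀ j, k j < N :=
    ⟨Finset.univ.sup k + 1, fun j => Nat.lt_succ_of_le (Finset.le_sup (Finset.mem_univ j))⟩
  have hN0 : 1 ≤ N := (Nat.zero_le _).trans_lt (hN ⟨0, hn⟩)
  have hnN : n ≤ N := by
    simpa using Fintype.card_le_of_injective (fun j => (⟨k j, hN j⟩ : Fin N))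
      fun i j hij => hk.injective (Fin.mk.inj_iff.1 hij)
  -- The coefficients `a`, moved to the positions `k j` and extended by zero.
  let b : Fin N → ℝ := fun i => ∑ j, if k j = i then a j else 0
  have hbk : ∀ j, b ⟨k j, hN j⟩ = a j := fun j => by
    simp [b, hk.injective.eq_iff]
  have hb : ∀ i, b i ∈ Set.Icc (-1 : ℝ) 1 := by
    intro i
    by_cases h : ∃ j, k j = i
    · obtain ⟨j, hj⟩ := h
      rw [show i = ⟨k j, hN j⟩ from Fin.ext hj.symm, hbk]
      exact ha j
    · have : b i = 0 := Finset.sum_eq_zero fun j _ => if_neg fun hj => h ⟨j, hj⟩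
      simp [this]
  have hle : ∀ l ≥ N, |‖∑ j : Fin n, a j • e j‖ - ‖∑ j, a j • e (k j)‖| ≤ 2 * δ l := by
    intro l hl
    obtain ⟨W, hWF, hWz, hW⟩ := exists_plegma_columns hF hF1 hL hsub hnull l N one_pos
    have hWne : ∀ i : Fin N, ∃ s, s ∈ W i := fun i => by
      obtain ⟨z, hz, -⟩ := hWz i i.2
      exact (convexHull_nonempty_iff.1 ⟨z, hz⟩).of_image
    choose s hs using hWne
    obtain ⟨hp, hl1⟩ := hW N hN0 Fin.val Fin.val_strictMono (fun i => i.2) s hs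
    obtain ⟨hp', hl1'⟩ := hW n hn k hk hN (fun j => s ⟨k j, hN j⟩) fun j => hs ⟨k j, hN j⟩
    have h1 := hgen l N hN0 hl b hb s (fun i => hWF i i.2 (hs i)) hp hl1
    have h2 := hgen l n hn (hnN.trans hl) a ha _ (fun j => hWF _ (hN j) (hs ⟨k j, hN j⟩)) hp' hl1'
    rw [sum_extend_smul hN a (fun i => x (s i)), sum_extend_smul hN a (fun i => e i)] at h1
    rw [abs_le] at h1 h2 ⊢
    constructor <;> linarith
  have hlim : Tendsto (fun l => 2 * δ l) atTop (𝓝 0) := by simpa using hδ.const_mul 2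
  have := ge_of_tendsto hlim ((eventually_ge_atTop N).mono hle)
  exact sub_eq_zero.1 (abs_nonpos_iff.1 this)

/-- Replacing one coefficient by `0` does not increase the norm. In the linear combination of the
vectors of a plegma family one averages over the vector at the position `p`: each of the sums
averaged has norm close to that of `∑ a j • e j`, and the average of that vector is almost zero. -/
theorem norm_sum_update_le_of_generates {F : Set (Finset ℕ)} (hF : IsRegularThin F)
    (hF1 : ∃ s ∈ F, s.Nonempty) {L : Set ℕ} (hL : L.Infinite) {x : Finset ℕ → X} {e : ℕ → E}
    (hgen : GeneratesSpreadingModel F L x e) (hsub : IsWeaklySubordinated F L x)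
    (hnull : IsWeaklyNull F L x) {n : ℕ} (a : Fin n → ℝ) (p : Fin n) :
    ‖∑ j, Function.update a p 0 j • e j‖ ≤ ‖∑ j, a j • e j‖ := by
  obtain ⟨δ, -, hδ, hgen⟩ := hgen
  suffices h : ∀ a : Fin n → ℝ, (∀ j, a j ∈ Set.Icc (-1 : ℝ) 1) →
      ‖∑ j, Function.update a p 0 j • e j‖ ≤ ‖∑ j, a j • e j‖ by
    obtain ⟨c, hc, b, hb, rfl⟩ := exists_smul_mem_Icc a
    have hupd : Function.update (c • b) p 0 = c • Function.update b p 0 := by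
      rw [← Function.update_smul, smul_zero]
    rw [hupd, norm_sum_smul_smul hc, norm_sum_smul_smul hc]
    exact mul_le_mul_of_nonneg_left (h b hb) hc.le
  intro a ha
  have hn : 1 ≤ n := (Nat.zero_le _).trans_lt p.2
  have ha' : ∀ j, Function.update a p 0 j ∈ Set.Icc (-1 : ℝ) 1 := by
    intro j
    rcases eq_or_ne j p with rfl | hj
    · simp
    · simpa [hj] using ha j
  have hle : ∀ l ≥ n, ‖∑ j, Function.update a p 0 j • e j‖ ≤ ‖∑ j, a j • e j‖ + 2 * δ l := by
    intro l hl
    refine le_of_forall_pos_le_add fun ε hε => ?_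
    obtain ⟨W, hWF, hWz, hW⟩ := exists_plegma_columns hF hF1 hL hsub hnull l n hε
    have hWne : ∀ i : Fin n, ∃ s, s ∈ W i := fun i => by
      obtain ⟨z, hz, -⟩ := hWz i i.2
      exact (convexHull_nonempty_iff.1 ⟨z, hz⟩).of_image
    choose s hs using hWne
    have happrox : ∀ b : Fin n → ℝ, (∀ j, b j ∈ Set.Icc (-1 : ℝ) 1) →
        ∀ t : Fin n → Finset ℕ, (∀ i : Fin n, t i ∈ W i) →
          |‖∑ j, b j • x (t j)‖ - ‖∑ j : Fin n, b j • e j‖| ≤ δ l := by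
      intro b hb t ht
      obtain ⟨hp, hl1⟩ := hW n hn Fin.val Fin.val_strictMono (fun i => i.2) t ht
      exact hgen l n hn hl b hb t (fun i => hWF i i.2 (ht i)) hp hl1
    set y := ∑ j, Function.update a p 0 j • x (s j) with hy
    have hsub : x '' W p ⊆ (fun z => a p • z) ⁻¹'
        Metric.closedBall (-y) (‖∑ j, a j • e j‖ + δ l) := by
      rintro _ ⟨r, hr, rfl⟩
      have h1 := happrox a ha (Function.update s p r) fun i => by
        rcases eq_or_ne i p with rfl | hi
        · simpa using hr
        · simpa [hi] using hs i
      have h2 : ∑ j, a j • x (Function.update s p r j) = a p • x r + y := by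
        rw [hy, ← Finset.add_sum_erase _ _ (Finset.mem_univ p),
          ← Finset.add_sum_erase (f := fun j => Function.update a p 0 j • x (s j)) _
            (Finset.mem_univ p)]
        simp only [Function.update_self, zero_smul, zero_add]
        congr 1
        refine Finset.sum_congr rfl fun j hj => ?_
        rw [Function.update_of_ne (Finset.ne_of_mem_erase hj),
          Function.update_of_ne (Finset.ne_of_mem_erase hj)]
      rw [h2, abs_le] at h1
      rw [Set.mem_preimage, mem_closedBall_iff_norm, sub_neg_eq_add]
      linarith
    obtain ⟨z, hz, hzε⟩ := hWz p p.2
    have hzy := convexHull_min hsub ((convex_closedBall _ _).smul_preimage _) hz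
    rw [Set.mem_preimage, mem_closedBall_iff_norm, sub_neg_eq_add] at hzy
    have hap : ‖a p • z‖ ≤ ε := by
      rw [norm_smul]
      exact (mul_le_of_le_one_left (norm_nonneg _) (abs_le.2 (ha p))).trans hzε
    have hyle : ‖y‖ ≤ ‖a p • z + y‖ + ‖a p • z‖ := by
      simpa using norm_sub_le (a p • z + y) (a p • z)
    have h3 := (abs_le.1 (happrox _ ha' s hs)).1
    rw [← hy] at h3
    linarith
  have hlim : Tendsto (fun l => ‖∑ j, a j • e j‖ + 2 * δ l) atTop (𝓝 ‖∑ j, a j • e j‖) := by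
    simpa using (hδ.const_mul 2).const_add ‖∑ j, a j • e j‖
  exact ge_of_tendsto hlim ((eventually_ge_atTop n).mono hle)

theorem isUnconditionalSeq_of_generates {F : Set (Finset ℕ)} (hF : IsRegularThin F)
    (hF1 : ∃ s ∈ F, s.Nonempty) {L : Set ℕ} (hL : L.Infinite) {x : Finset ℕ → X} {e : ℕ → E}
    (hgen : GeneratesSpreadingModel F L x e) (hsub : IsWeaklySubordinated F L x)
    (hnull : IsWeaklyNull F L x) : IsUnconditionalSeq 1 e := by
  classical
  intro m G hG a
  have key : ∀ H ⊆ Finset.range m, ‖∑ n ∈ Finset.range m \ H, a n • e n‖ ≤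
      ‖∑ n ∈ Finset.range m, a n • e n‖ := by
    intro H
    induction H using Finset.induction_on with
    | empty => simp
    | insert p H hp ih =>
      intro hH
      obtain ⟨hpm, hH⟩ := Finset.insert_subset_iff.1 hH
      refine le_trans ?_ (ih hH)
      have h0 : ∀ K : Finset ℕ, ∑ n ∈ Finset.range m \ K, a n • e n =
          ∑ j : Fin m, (if (j : ℕ) ∈ K then 0 else a j) • e j := by
        intro K
        rw [Fin.sum_univ_eq_sum_range (fun j => (if j ∈ K then 0 else a j) • e j) m,
          Finset.sdiff_eq_filter, Finset.sum_filter]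
        refine Finset.sum_congr rfl fun n _ => ?_
        by_cases h : n ∈ K <;> simp [h]
      rw [h0, h0]
      have hpm' := Finset.mem_range.1 hpm
      have hupd : (fun j : Fin m => if (j : ℕ) ∈ insert p H then 0 else a j) =
          Function.update (fun j : Fin m => if (j : ℕ) ∈ H then 0 else a j) ⟨p, hpm'⟩ 0 := by
        ext j
        by_cases hj : j = ⟨p, hpm'⟩
        · subst hj
          simp
        · have : (j : ℕ) ≠ p := fun h => hj (Fin.ext h)
          simp [hj, this]
      have := norm_sum_update_le_of_generates hF hF1 hL hgen hsub hnull
        (fun j : Fin m => if (j : ℕ) ∈ H then 0 else a j) ⟨p, hpm'⟩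
      rwa [← hupd] at this
  rw [one_mul]
  simpa [Finset.sdiff_sdiff_eq_self hG] using key (Finset.range m \ G) Finset.sdiff_subset

/-- All the `e n` have the same norm, which is bounded below by the lower bound of the `‖x s‖`. -/
theorem norm_pos_of_generates {F : Set (Finset ℕ)} (hF : IsRegularThin F)
    (hF1 : ∃ s ∈ F, s.Nonempty) {L : Set ℕ} (hL : L.Infinite) {x : Finset ℕ → X} {e : ℕ → E}
    (hgen : GeneratesSpreadingModel F L x e) (hsn : IsSeminormalized F L x)
    (hsub : IsWeaklySubordinated F L x) (hnull : IsWeaklyNull F L x) (n : ℕ) : 0 < ‖e n‖ := by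
  have hspr := isSpreadingSeq_of_generates hF hF1 hL hgen hsub hnull 1 (fun _ => 1)
    (fun _ => n) (Subsingleton.strictMono _)
  simp only [Finset.univ_unique, Finset.sum_singleton, one_smul, Fin.default_eq_zero,
    Fin.val_zero] at hspr
  rw [← hspr]
  obtain ⟨δ, -, hδ, hgen⟩ := hgen
  obtain ⟨c, C, hc, -, hcC⟩ := hsn
  refine hc.trans_le ?_
  have hle : ∀ l ≥ 1, c ≤ ‖e 0‖ + δ l := by
    intro l hl
    obtain ⟨W, hWF, hWz, hW⟩ := exists_plegma_columns hF hF1 hL hsub hnull l 1 one_pos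
    obtain ⟨z, hz, -⟩ := hWz 0 one_pos
    obtain ⟨s, hs⟩ := (convexHull_nonempty_iff.1 ⟨z, hz⟩).of_image
    obtain ⟨hp, hl1⟩ := hW 1 le_rfl (fun _ => 0) (Subsingleton.strictMono _)
      (fun _ => one_pos) (fun _ => s) fun _ => hs
    have h := hgen l 1 le_rfl hl (fun _ => 1) (by simp) (fun _ => s)
      (fun _ => hWF 0 one_pos hs) hp hl1
    simp only [Finset.univ_unique, Finset.sum_singleton, one_smul, Fin.default_eq_zero,
      Fin.val_zero] at h
    have h1 := (abs_le.1 h).2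
    have h2 := (hcC s (hWF 0 one_pos hs)).1
    linarith
  have hlim : Tendsto (fun l => ‖e 0‖ + δ l) atTop (𝓝 ‖e 0‖) := by
    simpa using hδ.const_add ‖e 0‖
  exact ge_of_tendsto hlim ((eventually_ge_atTop 1).mono hle)

theorem IsUnconditionalSeq.not_isTrivialSeq {C : ℝ} {e : ℕ → E} (h : IsUnconditionalSeq C e)
    (he : ∀ n, 0 < ‖e n‖) : ¬ IsTrivialSeq e := by
  rintro ⟨k, a, ⟨j, hj⟩, h0⟩
  have h1 := h k {(j : ℕ)} (by simp) fun n => if hn : n < k then a ⟨n, hn⟩ else 0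
  rw [← Fin.sum_univ_eq_sum_range (fun n => (if hn : n < k then a ⟨n, hn⟩ else 0) • e n)] at h1
  simp only [Finset.sum_singleton, Fin.is_lt, dite_true, Fin.eta, h0, mul_zero, norm_smul] at h1
  exact h1.not_gt (mul_pos (norm_pos_iff.2 hj) (he j))

end SpreadingModel

end HOSM

theorem theorem6p12
    {X : Type*} [NormedAddCommGroup X] [NormedSpace ℝ X] [CompleteSpace X]
    {E : Type*} [SeminormedAddCommGroup E] [NormedSpace ℝ E]
    (F : Set (Finset ℕ)) (hF : HOSM.IsRegularThin F) (hF1 : ∃ s ∈ F, s.Nonempty)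
    (L : Set ℕ) (hL : L.Infinite)
    (x : Finset ℕ → X) (e : Module.Basis ℕ ℝ E)
    (hgen : HOSM.GeneratesSpreadingModel F L x e)
    (hsn : HOSM.IsSeminormalized F L x)
    (hsub : HOSM.IsWeaklySubordinated F L x)
    (hnull : HOSM.IsWeaklyNull F L x) :
    HOSM.IsSpreadingSeq e ∧ ¬ HOSM.IsTrivialSeq e ∧ HOSM.IsUnconditionalSeq 1 e := by
  have hunc := HOSM.isUnconditionalSeq_of_generates hF hF1 hL hgen hsub hnull
  exact ⟨HOSM.isSpreadingSeq_of_generates hF hF1 hL hgen hsub hnull,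
    hunc.not_isTrivialSeq (HOSM.norm_pos_of_generates hF hF1 hL hgen hsn hsub hnull), hunc⟩
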